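/- Let $K$ be a field of characteristic $0$ and let $Y\subseteq K^n$ be an affine variety, that is, an irreducible Zariski closed subset of $K^n$. Let $\sigma$ be an automorphism of $Y$, that is, a bijection $\sigma:Y\to Y$ such that $\sigma$ and $\sigma^{-1}$ are both given by $n$-tuples of polynomials with coefficients in $K$, and let $q\in Y$. Then the orbit $\{\sigma^m(q) : m\in\mathbb{Z}\}$ is Zariski dense in $Y$ if and only if, for every proper subvariety $X$ of $Y$ (that is, every Zariski closed subset $X\subsetneq Y$, irreducible or not), the set $\{m\in\mathbb{Z} : \sigma^m(q)\in X\}$ is finite. -/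

import Mathlib

/-- Affine `n`-space over `K`: a point is an `n`-tuple of coordinates in `K`.  (It is a copy of
`Fin n → K`, so that the Zariski topology below never competes with a product topology.) -/
@[ext]
structure AffSpace (K : Type*) (n : ℕ) where
  coords : Fin n → K

namespace AffSpace

variable {K : Type*} [Field K] {n : ℕ}

/-- The set of common zeros in affine `n`-space of an ideal of `K[x₁, …, xₙ]`. -/
def zeros (I : Ideal (MvPolynomial (Fin n) K)) : Set (AffSpace K n) :=
  {x | x.coords ∈ MvPolynomial.zeroLocus K I}

theorem mem_zeros {I : Ideal (MvPolynomial (Fin n) K)} {x : AffSpace K n} :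
    x ∈ zeros I ↔ ∀ p ∈ I, MvPolynomial.eval x.coords p = 0 := by
  simp [zeros]

/-- The Zariski topology on affine `n`-space: the closed sets are the zero sets of ideals. -/
instance zariskiTopology : TopologicalSpace (AffSpace K n) :=
  TopologicalSpace.ofClosed {Z | ∃ I : Ideal (MvPolynomial (Fin n) K), Z = zeros I}
    ⟨⊤, by ext x; simp [zeros]⟩
    (by
      intro A hA
      refine ⟨sSup {I | zeros I ∈ A}, ?_⟩
      apply Set.Subset.antisymm
      · intro x hx
        have h : sSup {I : Ideal (MvPolynomial (Fin n) K) | zeros I ∈ A} ≤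
            MvPolynomial.vanishingIdeal K {x.coords} :=
          sSup_le fun I hI => MvPolynomial.le_zeroLocus_iff_le_vanishingIdeal.1
            (Set.singleton_subset_iff.2 (hx _ hI))
        exact MvPolynomial.le_zeroLocus_iff_le_vanishingIdeal.2 h rfl
      · intro x hx Z hZ
        obtain ⟨I, rfl⟩ := hA hZ
        exact MvPolynomial.zeroLocus_anti_mono (le_sSup (show I ∈ {I | zeros I ∈ A} from hZ)) hx)
    (by
      rintro _ ⟨I, rfl⟩ _ ⟨J, rfl⟩
      refine ⟨I ⊓ J, ?_⟩
      ext x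
      simp only [Set.mem_union, mem_zeros]
      constructor
      · rintro (h | h) p hp
        · exact h p hp.1
        · exact h p hp.2
      · intro h
        by_contra! hc
        obtain ⟨⟨p, hp, hp0⟩, q, hq, hq0⟩ := hc
        have hpq := h (p * q) ⟨I.mul_mem_right q hp, J.mul_mem_left p hq⟩
        rw [map_mul] at hpq
        exact (mul_ne_zero hp0 hq0) hpq)

theorem isClosed_iff {Z : Set (AffSpace K n)} :
    IsClosed Z ↔ ∃ I : Ideal (MvPolynomial (Fin n) K), Z = zeros I := by
  rw [← isOpen_compl_iff]
  change (∃ I : Ideal (MvPolynomial (Fin n) K), Zᶜᶜ = zeros I) ↔ _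
  rw [compl_compl]

/-- An affine variety in affine `n`-space: a Zariski closed subset that is irreducible
(in particular nonempty) in the Zariski topology. -/
def IsAffineVariety (Y : Set (AffSpace K n)) : Prop :=
  IsClosed Y ∧ IsIrreducible Y

/-- A map `Y → Y` that is given by an `n`-tuple of polynomials in the coordinates. -/
def IsPolynomialMap {Y : Set (AffSpace K n)} (f : Y → Y) : Prop :=
  ∃ F : Fin n → MvPolynomial (Fin n) K,
    ∀ (y : Y) (i : Fin n), (f y).1.coords i = MvPolynomial.eval y.1.coords (F i)

/-- A bijection of `Y` is an automorphism if it and its inverse are polynomial maps. -/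
def IsAutomorphism {Y : Set (AffSpace K n)} (σ : Equiv.Perm Y) : Prop :=
  IsPolynomialMap (σ : Y → Y) ∧ IsPolynomialMap (σ.symm : Y → Y)

end AffSpace

/-!
If the orbit of `q` meets no proper closed set infinitely often, it is dense because its closure
contains all of it. The converse is a Skolem-Mahler-Lech statement: if infinitely many `σ ^ m q`
lie in a proper closed set, then a two-sided arithmetic progression of them lies in a proper
closed set `X'`, so finitely many translates of `X'` cover the dense orbit, hence the irreducible
`Y`, and one translate is all of `Y`, which is absurd (`AffSpace.IsAutomorphism.finite_of_dense`).

To find the progression, pick a polynomial `f` that vanishes on the closed set but not on `Y`. If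
`F` and `G` are polynomial vectors representing `σ` and its inverse, the map
`(a, b) ↦ (b + F a, a - G (b + F a))` is an invertible polynomial map of the affine space of twice
the dimension and extends `σ` on `Y × 0` (`MvPolynomial.henonMap`), so the variety may be forgotten.
All data lie in a finitely generated ring, which embeds into a finite free `ℤ_[p]`-algebra `A` for a
suitable prime `p` (`exists_injective_to_finite_free_padicInt_algebra`).

Over `A`, put `s = p ^ 2`. The map permutes the finite set of points modulo `s ^ 2`, so some iterate
`T` is the identity on points modulo `s ^ 2`. Rescaling the residue class of a point `q` by
`x = q + s y` turns `T` into `y ↦ y + s S y` with `S` a polynomial map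
(`MvPolynomial.exists_eval_eq_of_dvd_sub`). Hence the `k`-th differences of `m ↦ f (T ^ m q)` are
divisible by `s ^ k`, and in coordinates this sequence is a series in the falling factorials of `m`
with coefficients divisible by `p ^ k`, because `p ^ k / k!` is integral. By Strassmann's argument
(`PadicInt.eq_zero_of_infinite_zeros_descFactorial_sum`) infinitely many zeros force it to vanish.
-/

/-! ### Zeros of interpolable integer sequences -/

/-- **Strassmann's bound**, for falling factorial series. If `b k` is divisible by `p ^ k` and
`n ↦ ∑ b k * n (n - 1) ⋯ (n - k + 1)` has infinitely many zeros in `ℕ`, then all `b k` vanish. -/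
theorem PadicInt.eq_zero_of_infinite_zeros_descFactorial_sum {p : ℕ} [Fact p.Prime]
    (b : ℕ → ℤ_[p]) (hb : ∀ k, (p : ℤ_[p]) ^ k ∣ b k)
    (hz : {n : ℕ | ∑ k ∈ Finset.range (n + 1), b k * (n.descFactorial k : ℤ_[p]) = 0}.Infinite)
    (k : ℕ) : b k = 0 := by
  classical
  by_contra hk
  have hp0 : (p : ℤ_[p]) ≠ 0 := PadicInt.prime_p.ne_zero
  have hex : ∃ j, ∃ k, ¬ (p : ℤ_[p]) ^ (j + 1) ∣ b k := by
    have hfin : FiniteMultiplicity (p : ℤ_[p]) (b k) :=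
      FiniteMultiplicity.of_prime_left PadicInt.prime_p hk
    obtain ⟨j, hj⟩ := hfin
    exact ⟨j, k, hj⟩
  -- `p ^ j` is the exact power of `p` dividing all the `b k`.
  obtain ⟨j, hj, hjmin⟩ : ∃ j, (∃ k, ¬ (p : ℤ_[p]) ^ (j + 1) ∣ b k) ∧
      ∀ k, (p : ℤ_[p]) ^ j ∣ b k := by
    refine ⟨Nat.find hex, Nat.find_spec hex, fun k => ?_⟩
    rcases h : Nat.find hex with _ | i
    · simp
    · by_contra hc
      exact Nat.find_min hex (m := i) (by omega) ⟨k, hc⟩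
  have hbd : ∀ k, ¬ (p : ℤ_[p]) ^ (j + 1) ∣ b k → k ≤ j := by
    intro k hk
    by_contra! hlt
    exact hk ((pow_dvd_pow _ hlt).trans (hb k))
  -- `K` is the last index at which the minimal valuation is attained.
  set K := Nat.findGreatest (fun k => ¬ (p : ℤ_[p]) ^ (j + 1) ∣ b k) j with hKdef
  obtain ⟨k₀, hk₀⟩ := hj
  have hK : ¬ (p : ℤ_[p]) ^ (j + 1) ∣ b K :=
    Nat.findGreatest_spec (P := fun k => ¬ (p : ℤ_[p]) ^ (j + 1) ∣ b k) (hbd k₀ hk₀) hk₀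
  have hKlt : ∀ k, K < k → (p : ℤ_[p]) ^ (j + 1) ∣ b k := by
    intro k hlt
    by_contra hc
    exact absurd (Nat.le_findGreatest (P := fun k => ¬ (p : ℤ_[p]) ^ (j + 1) ∣ b k)
      (hbd k hc) hc) (by omega)
  choose c hc using hjmin
  have hker : ∀ x : ℤ_[p], (PadicInt.toZMod x = 0) ↔ (p : ℤ_[p]) ∣ x := by
    intro x
    rw [← RingHom.mem_ker, PadicInt.ker_toZMod, PadicInt.maximalIdeal_eq_span_p,
      Ideal.mem_span_singleton]
  have hdvd : ∀ k, (p : ℤ_[p]) ^ (j + 1) ∣ b k ↔ (p : ℤ_[p]) ∣ c k := by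
    intro k
    rw [hc k, pow_succ, mul_dvd_mul_iff_left (pow_ne_zero _ hp0)]
  obtain ⟨s, hs, hscard⟩ := hz.exists_subset_card_eq (K + 1)
  set M := K + s.sup id with hM
  set V : Polynomial ℤ_[p] := ∑ k ∈ Finset.range (M + 1),
    Polynomial.C (c k) * descPochhammer ℤ_[p] k with hV
  have hroot : ∀ n ∈ s, V.eval (n : ℤ_[p]) = 0 := by
    intro n hn
    have hnM : n ≤ M := le_trans (Finset.le_sup (f := id) hn) (by omega)
    have h0 : ∑ k ∈ Finset.range (n + 1), b k * (n.descFactorial k : ℤ_[p]) = 0 := hs hn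
    have h1 : (p : ℤ_[p]) ^ j * V.eval (n : ℤ_[p]) = 0 := by
      rw [← h0, hV, Polynomial.eval_finsetSum, Finset.mul_sum]
      symm
      refine Finset.sum_subset_zero_on_sdiff (by simpa using hnM) ?_ ?_
      · intro k hk
        simp only [Finset.mem_sdiff, Finset.mem_range, not_lt] at hk
        simp [descPochhammer_eval_eq_descFactorial,
          Nat.descFactorial_eq_zero_iff_lt.2 (show n < k by omega)]
      · intro k _
        rw [hc k]
        simp [descPochhammer_eval_eq_descFactorial, mul_assoc]
    exact (mul_eq_zero.1 h1).resolve_left (pow_ne_zero _ hp0)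
  -- Modulo `p` the polynomial `V` has degree exactly `K`, but it has more than `K` roots.
  have hW : V.map (PadicInt.toZMod (p := p)) = ∑ k ∈ Finset.range (K + 1),
      Polynomial.C (PadicInt.toZMod (c k)) * descPochhammer (ZMod p) k := by
    rw [hV, Polynomial.map_sum]
    symm
    refine Finset.sum_subset_zero_on_sdiff ?_ ?_ ?_
    · intro k; simp only [Finset.mem_range]; omega
    · intro k hk
      simp only [Finset.mem_sdiff, Finset.mem_range, not_lt] at hk
      have := (hker (c k)).2 ((hdvd k).1 (hKlt k (by omega)))
      simp [this]
    · intro k _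
      simp [descPochhammer_map]
  have hdeg : (V.map (PadicInt.toZMod (p := p))).natDegree ≤ K := by
    rw [hW]
    refine Polynomial.natDegree_sum_le_of_forall_le _ _ fun k hk => ?_
    refine (Polynomial.natDegree_C_mul_le _ _).trans ?_
    rw [descPochhammer_natDegree]
    simpa [Nat.lt_succ_iff] using hk
  have hne : V.map (PadicInt.toZMod (p := p)) ≠ 0 := by
    intro h0
    have hcoef : (V.map (PadicInt.toZMod (p := p))).coeff K = PadicInt.toZMod (c K) := by
      rw [hW, Finset.sum_range_succ, Polynomial.coeff_add, Polynomial.finsetSum_coeff,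
        Finset.sum_eq_zero, zero_add, Polynomial.coeff_C_mul]
      · have h1 : (descPochhammer (ZMod p) K).coeff K = 1 := by
          have := monic_descPochhammer (ZMod p) K
          rwa [Polynomial.Monic, Polynomial.leadingCoeff, descPochhammer_natDegree] at this
        rw [h1, mul_one]
      · intro k hk
        rw [Polynomial.coeff_C_mul, Polynomial.coeff_eq_zero_of_natDegree_lt, mul_zero]
        rw [descPochhammer_natDegree]
        simpa using hk
    rw [h0, Polynomial.coeff_zero] at hcoef
    exact hK ((hdvd K).2 ((hker _).1 hcoef.symm))
  have hV0 : V ≠ 0 := by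
    rintro h; rw [h] at hne; simp at hne
  have hcard : K + 1 ≤ V.roots.card := by
    rw [← hscard, ← Finset.card_image_of_injective s (Nat.cast_injective (R := ℤ_[p]))]
    refine (Finset.card_le_card (t := V.roots.toFinset) ?_).trans (Multiset.toFinset_card_le _)
    intro x hx
    obtain ⟨n, hn, rfl⟩ := Finset.mem_image.1 hx
    rw [Multiset.mem_toFinset, Polynomial.mem_roots hV0]
    exact hroot n hn
  have := Polynomial.card_roots_le_map hne
  have := Polynomial.card_roots' (V.map (PadicInt.toZMod (p := p)))
  omega

/-- `p ^ k / k!` is a `p`-adic integer. -/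
theorem PadicInt.exists_factorial_mul_eq_pow (p : ℕ) [hp : Fact p.Prime] (k : ℕ) :
    ∃ e : ℤ_[p], (k.factorial : ℤ_[p]) * e = (p : ℤ_[p]) ^ k := by
  have hk : k.factorial ≠ 0 := k.factorial_ne_zero
  obtain ⟨m, hm⟩ := pow_padicValNat_dvd (p := p) (n := k.factorial)
  have hle : padicValNat p k.factorial ≤ k := by
    have h := sub_one_mul_padicValNat_factorial (p := p) k
    have h2 := hp.out.two_le
    have : 1 * padicValNat p k.factorial ≤ (p - 1) * padicValNat p k.factorial :=
      Nat.mul_le_mul_right _ (by omega)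
    omega
  have hmu : IsUnit (m : ℤ_[p]) := by
    have hpm : ¬ p ∣ m := by
      rintro ⟨t, ht⟩
      refine pow_succ_padicValNat_not_dvd (p := p) hk ⟨t, ?_⟩
      conv_lhs => rw [hm, ht]
      ring
    rw [PadicInt.isUnit_iff, PadicInt.norm_natCast_eq_one_iff]
    exact (hp.out.coprime_iff_not_dvd).2 hpm
  obtain ⟨u, hu⟩ := hmu
  refine ⟨(↑u⁻¹ : ℤ_[p]) * (p : ℤ_[p]) ^ (k - padicValNat p k.factorial), ?_⟩
  have hmc : (k.factorial : ℤ_[p]) = (p : ℤ_[p]) ^ padicValNat p k.factorial * u := by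
    rw [hu]
    exact_mod_cast congrArg (Nat.cast (R := ℤ_[p])) hm
  rw [hmc]
  calc _ = (p : ℤ_[p]) ^ padicValNat p k.factorial * (p : ℤ_[p]) ^ (k - padicValNat p k.factorial)
        * (↑u * ↑u⁻¹) := by ring
    _ = _ := by rw [← pow_add, Nat.add_sub_of_le hle]; simp

/-- A sequence of `p`-adic integers whose `k`-th differences are divisible by `p ^ (2 * k)` is
the restriction of a `p`-adic analytic function; it vanishes once it has infinitely many zeros. -/
theorem PadicInt.eq_zero_of_dvd_fwdDiff {p : ℕ} [Fact p.Prime] (v : ℤ → ℤ_[p])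
    (hv : ∀ (k : ℕ) (m : ℤ), (p : ℤ_[p]) ^ (2 * k) ∣ (fwdDiff 1)^[k] v m)
    (hz : {n : ℕ | v n = 0}.Infinite) (m : ℤ) : v m = 0 := by
  -- The expansion is based at a point `t` to the left of both `0` and `m`.
  set t : ℤ := min m 0 with ht
  choose d hd using fun k => hv k t
  choose e he using PadicInt.exists_factorial_mul_eq_pow p
  have hexp : ∀ n : ℕ, v (t + n) = ∑ k ∈ Finset.range (n + 1),
      ((p : ℤ_[p]) ^ k * (d k * e k)) * (n.descFactorial k : ℤ_[p]) := by
    intro n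
    have h := shift_eq_sum_fwdDiff_iter (1 : ℤ) v n t
    rw [nsmul_eq_mul, mul_one] at h
    rw [h]
    refine Finset.sum_congr rfl fun k _ => ?_
    rw [hd k, Nat.descFactorial_eq_factorial_mul_choose, nsmul_eq_mul, Nat.cast_mul, two_mul,
      pow_add]
    nth_rewrite 2 [← he k]
    ring
  have hb : ∀ k, (p : ℤ_[p]) ^ k * (d k * e k) = 0 := by
    refine PadicInt.eq_zero_of_infinite_zeros_descFactorial_sum _ (fun k => dvd_mul_right _ _) ?_
    have hinj : Function.Injective (fun n : ℕ => n + (-t).toNat) := add_left_injective _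
    refine (hz.image hinj.injOn).mono ?_
    rintro _ ⟨n, hn, rfl⟩
    simp only [Set.mem_ofPred_eq] at hn ⊢
    rw [← hexp]
    rw [← hn]
    congr 1
    push_cast
    omega
  have h := hexp (m - t).toNat
  rw [Finset.sum_eq_zero (fun k _ => by rw [hb k, zero_mul])] at h
  rw [← h]
  congr 1
  omega

/-! ### Polynomial maps close to the identity -/

namespace MvPolynomial

variable {ι A : Type*} [CommRing A]

/-- The Taylor expansion of a polynomial to first order, the increment being a multiple of `s`. -/
theorem exists_eval_add_smul_eq [Fintype ι] (P : MvPolynomial ι A) (q : ι → A) (s : A) :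
    ∃ (l : ι → A) (R : MvPolynomial ι A), ∀ y : ι → A,
      eval (q + s • y) P = eval q P + s * ∑ j, l j * y j + s ^ 2 * eval y R := by
  classical
  induction P using MvPolynomial.induction_on with
  | C a => exact ⟨0, 0, fun y => by simp⟩
  | add f g hf hg =>
    obtain ⟨l, R, h⟩ := hf
    obtain ⟨l', R', h'⟩ := hg
    refine ⟨l + l', R + R', fun y => ?_⟩
    simp only [map_add, h, h', Pi.add_apply, add_mul, Finset.sum_add_distrib]
    ring
  | mul_X f i hf =>
    obtain ⟨l, R, h⟩ := hf
    refine ⟨fun j => q i * l j + if j = i then eval q f else 0,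
      (∑ j, C (l j) * X j) * X i + C (q i) * R + C s * R * X i, fun y => ?_⟩
    have h1 : ∑ j, (q i * l j + if j = i then eval q f else 0) * y j =
        q i * ∑ j, l j * y j + eval q f * y i := by
      simp [add_mul, Finset.sum_add_distrib, Finset.mul_sum, mul_assoc]
    rw [map_mul, h, h1]
    simp only [map_mul, map_add, map_sum, eval_C, eval_X, Pi.add_apply, Pi.smul_apply, smul_eq_mul]
    ring

/-- Moving the argument of a polynomial by `s` times a polynomial vector changes the value by
`s` times a polynomial. -/
theorem exists_eval_add_smul_eval_eq (P : MvPolynomial ι A) (S : ι → MvPolynomial ι A) (s : A) :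
    ∃ R : MvPolynomial ι A, ∀ y : ι → A,
      eval (y + s • fun i => eval y (S i)) P = eval y P + s * eval y R := by
  induction P using MvPolynomial.induction_on with
  | C a => exact ⟨0, fun y => by simp⟩
  | add f g hf hg =>
    obtain ⟨R, h⟩ := hf
    obtain ⟨R', h'⟩ := hg
    refine ⟨R + R', fun y => ?_⟩
    simp only [map_add, h, h']
    ring
  | mul_X f i hf =>
    obtain ⟨R, h⟩ := hf
    refine ⟨R * X i + f * S i + C s * R * S i, fun y => ?_⟩
    rw [map_mul, h]
    simp only [map_mul, map_add, eval_C, eval_X, Pi.add_apply, Pi.smul_apply, smul_eq_mul]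
    ring

/-- A polynomial map that is the identity modulo `s ^ 2` becomes, on the residue class `q + s A^ι`
and in the coordinates `y` with `x = q + s y`, the identity modulo `s` as a polynomial map.
Only the values of the map are assumed to be congruent to those of the identity: the congruence
for its derivative follows by evaluating at the basis vectors. -/
theorem exists_eval_eq_of_dvd_sub [Finite ι] (T : MvPolynomial ι A) (i : ι) (q : ι → A)
    {s : A} (hs : s ∈ nonZeroDivisors A) (hT : ∀ x : ι → A, s ^ 2 ∣ eval x T - x i) :
    ∃ S : MvPolynomial ι A, ∀ y : ι → A,
      eval (q + s • y) T = q i + s * (y i + s * eval y S) := by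
  classical
  have := Fintype.ofFinite ι
  obtain ⟨l, R, h⟩ := T.exists_eval_add_smul_eq q s
  obtain ⟨t, ht⟩ := hT q
  have hl : ∀ j, ∃ r, l j = (if j = i then 1 else 0) + s * r := by
    intro j
    obtain ⟨u, hu⟩ := hT (q + s • Pi.single j 1)
    have h1 : ∑ k, l k * (Pi.single j 1 : ι → A) k = l j := by
      simp [Pi.single_apply]
    have h2 : (Pi.single j 1 : ι → A) i = if j = i then 1 else 0 := by
      simp [Pi.single_apply, eq_comm]
    rw [h, h1, Pi.add_apply, Pi.smul_apply, smul_eq_mul, h2] at hu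
    refine ⟨u - t - eval (Pi.single j 1) R, ?_⟩
    refine (mul_cancel_left_mem_nonZeroDivisors hs).1 ?_
    linear_combination hu - ht
  choose r hr using hl
  refine ⟨C t + ∑ j, C (r j) * X j + R, fun y => ?_⟩
  have h3 : ∑ j, l j * y j = y i + s * ∑ j, r j * y j := by
    simp_rw [hr, add_mul, Finset.sum_add_distrib, Finset.mul_sum, mul_assoc]
    simp
  rw [h, h3]
  simp only [map_add, map_mul, map_sum, eval_C, eval_X]
  linear_combination ht

/-- The orbit sequence of a polynomial map that is the identity modulo `s`, composed with a
polynomial, has `k`-th differences divisible by `s ^ k`. -/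
theorem exists_fwdDiff_iter_eval_eq (S : ι → MvPolynomial ι A) (s : A) (y : ℤ → ι → A)
    (hy : ∀ m, y (m + 1) = y m + s • fun i => eval (y m) (S i)) (h : MvPolynomial ι A) (k : ℕ) :
    ∃ R : MvPolynomial ι A, (fwdDiff 1)^[k] (fun m => eval (y m) h) =
      fun m => s ^ k * eval (y m) R := by
  induction k with
  | zero => exact ⟨h, by simp⟩
  | succ k ih =>
    obtain ⟨R, hR⟩ := ih
    obtain ⟨R', hR'⟩ := R.exists_eval_add_smul_eval_eq S s
    refine ⟨R', ?_⟩
    rw [Function.iterate_succ_apply', hR]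
    ext m
    rw [fwdDiff, hy, hR']
    ring

/-- The polynomials describing the `k`-th iterate of the map given by `P`. -/
noncomputable def iterMap (P : ι → MvPolynomial ι A) : ℕ → ι → MvPolynomial ι A
  | 0 => X
  | k + 1 => fun i => bind₁ (iterMap P k) (P i)

theorem eval_bind₁_eq (P : ι → MvPolynomial ι A) (f : MvPolynomial ι A) (x : ι → A) :
    eval x (bind₁ P f) = eval (fun i => eval x (P i)) f :=
  eval₂Hom_bind₁ _ _ _ _

theorem eval_iterMap (P : ι → MvPolynomial ι A) (k : ℕ) (x : ι → A) :
    (fun i => eval x (iterMap P k i)) = (fun x i => eval x (P i))^[k] x := by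
  induction k with
  | zero => simp [iterMap]
  | succ k ih =>
    rw [Function.iterate_succ_apply', ← ih]
    ext i
    simp [iterMap, eval_bind₁_eq]

theorem eval_map_comp {B : Type*} [CommRing B] (φ : A →+* B) (f : MvPolynomial ι A) (x : ι → A) :
    eval (fun i => φ (x i)) (map φ f) = φ (eval x f) := by
  rw [eval_map]
  exact (eval₂_comp φ x f).symm

/-- Modulo an ideal of finite index, some iterate of an invertible polynomial map is the identity,
because the map permutes a finite set of residues. -/
theorem exists_iterate_sub_mem [Finite ι] (P Q : ι → MvPolynomial ι A)
    (hPQ : ∀ i, bind₁ P (Q i) = X i) (I : Ideal A) [Finite (A ⧸ I)] :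
    ∃ a : ℕ, 0 < a ∧ ∀ (x : ι → A) (i : ι), (fun x i => eval x (P i))^[a] x i - x i ∈ I := by
  let π := Ideal.Quotient.mk I
  let f : (ι → A ⧸ I) → (ι → A ⧸ I) := fun x i => eval x (map π (P i))
  let g : (ι → A ⧸ I) → (ι → A ⧸ I) := fun x i => eval x (map π (Q i))
  have hgf : Function.LeftInverse g f := by
    intro x
    ext i
    change eval (fun j => eval x (map π (P j))) (map π (Q i)) = x i
    rw [← eval_bind₁_eq, ← map_bind₁, hPQ, map_X, eval_X]
  have hf : Function.Bijective f := Finite.injective_iff_bijective.1 hgf.injective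
  let e : Equiv.Perm (ι → A ⧸ I) := Equiv.ofBijective f hf
  have hsemi : Function.Semiconj (fun (x : ι → A) i => π (x i)) (fun x i => eval x (P i)) f := by
    intro x
    ext i
    exact (eval_map_comp π (P i) x).symm
  refine ⟨orderOf e, orderOf_pos e, fun x i => ?_⟩
  have h1 : f^[orderOf e] = id := by
    have h2 : ⇑(e ^ orderOf e) = f^[orderOf e] := by
      rw [Equiv.Perm.coe_pow]; rfl
    rw [← h2, pow_orderOf_eq_one]; rfl
  have h3 := congrFun (hsemi.iterate_right (orderOf e) x) i
  rw [h1] at h3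
  exact Ideal.Quotient.eq.1 h3

end MvPolynomial

/-! ### Orbits over a finite free `ℤ_[p]`-algebra -/

/-- In a finite free module over `ℤ_[p]`, powers of `p` have finite index. -/
theorem PadicInt.finite_quotient_span_pow (p : ℕ) [hp : Fact p.Prime] (A : Type*) [CommRing A]
    [Algebra ℤ_[p] A] [Module.Finite ℤ_[p] A] [Module.Free ℤ_[p] A] (j : ℕ) :
    Finite (A ⧸ Ideal.span {(p : A) ^ j}) := by
  let B := Module.Free.chooseBasis ℤ_[p] A
  let g : A → Module.Free.ChooseBasisIndex ℤ_[p] A → ZMod (p ^ j) :=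
    fun x i => PadicInt.toZModPow j (B.repr x i)
  have : NeZero (p ^ j) := ⟨pow_ne_zero _ hp.out.ne_zero⟩
  refine Finite.of_injective (fun x : A ⧸ Ideal.span {(p : A) ^ j} => g x.out) fun x y hxy => ?_
  have hx : Ideal.Quotient.mk (Ideal.span {(p : A) ^ j}) x.out = x := Quotient.out_eq' x
  have hy : Ideal.Quotient.mk (Ideal.span {(p : A) ^ j}) y.out = y := Quotient.out_eq' y
  rw [← hx, ← hy, Ideal.Quotient.eq, Ideal.mem_span_singleton]
  have hc : ∀ i, ∃ c : ℤ_[p], B.repr (x.out - y.out) i = (p : ℤ_[p]) ^ j * c := by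
    intro i
    have h := congrFun hxy i
    have h2 : B.repr (x.out - y.out) i ∈ RingHom.ker (PadicInt.toZModPow (p := p) j) := by
      rw [RingHom.mem_ker, map_sub, Finsupp.sub_apply, map_sub]
      exact sub_eq_zero.2 h
    rw [PadicInt.ker_toZModPow, Ideal.mem_span_singleton] at h2
    exact h2
  choose c hc using hc
  refine ⟨∑ i, c i • B i, ?_⟩
  rw [← B.sum_repr (x.out - y.out), Finset.mul_sum]
  refine Finset.sum_congr rfl fun i _ => ?_
  rw [hc, mul_smul, Algebra.smul_def ((p : ℤ_[p]) ^ j)]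
  simp

/-- An infinite set of natural numbers meets some residue class modulo `a` in an infinite set. -/
theorem Set.Infinite.exists_infinite_residue {S : Set ℕ} (hS : S.Infinite) {a : ℕ} (ha : 0 < a) :
    ∃ b : ℕ, {n : ℕ | a * n + b ∈ S}.Infinite := by
  by_contra! hc
  refine hS (((Set.finite_lt_nat a).biUnion fun b _ =>
    ((hc b).image fun n => a * n + b)).subset fun n hn => ?_)
  simp only [Set.mem_iUnion]
  exact ⟨n % a, Nat.mod_lt _ ha, n / a, by simpa [Nat.div_add_mod] using hn,
    Nat.div_add_mod n a⟩

/-- The Skolem-Mahler-Lech theorem for invertible polynomial maps over a finite free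
`ℤ_[p]`-algebra. -/
theorem PadicInt.exists_eval_orbit_eq_zero {p : ℕ} [hp : Fact p.Prime] {A ι : Type*} [Finite ι]
    [CommRing A] [Algebra ℤ_[p] A] [Module.Finite ℤ_[p] A] [Module.Free ℤ_[p] A]
    (P Q : ι → MvPolynomial ι A) (hPQ : ∀ i, MvPolynomial.bind₁ P (Q i) = MvPolynomial.X i)
    (z : ℤ → ι → A) (hz : ∀ m, z (m + 1) = fun i => MvPolynomial.eval (z m) (P i))
    (h : MvPolynomial ι A) (hinf : {n : ℕ | MvPolynomial.eval (z n) h = 0}.Infinite) :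
    ∃ a : ℕ, 0 < a ∧ ∃ b : ℤ, ∀ m : ℤ, MvPolynomial.eval (z (a * m + b)) h = 0 := by
  open MvPolynomial in
  let B := Module.Free.chooseBasis ℤ_[p] A
  set s : A := (p : A) ^ 2 with hs
  have hsmul : ∀ (k : ℕ) (x : A), s ^ k * x = ((p : ℤ_[p]) ^ (2 * k)) • x := by
    intro k x
    rw [Algebra.smul_def, hs, ← pow_mul]
    simp
  have hsreg : s ∈ nonZeroDivisors A := by
    rw [mem_nonZeroDivisors_iff_right]
    intro x hx
    have h1 : (p : ℤ_[p]) ^ (2 * 1) • x = 0 := by rw [← hsmul, pow_one, mul_comm, hx]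
    refine B.repr.injective (Finsupp.ext fun i => ?_)
    have h2 := congrArg (fun x => B.repr x i) h1
    simp only [map_smul, Finsupp.smul_apply, smul_eq_mul, map_zero, Finsupp.zero_apply] at h2 ⊢
    exact (mul_eq_zero.1 h2).resolve_left (pow_ne_zero _ PadicInt.prime_p.ne_zero)
  have hfin : Finite (A ⧸ Ideal.span {s ^ 2}) := by
    rw [hs, ← pow_mul]
    exact PadicInt.finite_quotient_span_pow p A (2 * 2)
  obtain ⟨a, ha, hmod⟩ := exists_iterate_sub_mem P Q hPQ (Ideal.span {s ^ 2})
  refine ⟨a, ha, ?_⟩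
  obtain ⟨b, hb⟩ := hinf.exists_infinite_residue ha
  refine ⟨b, ?_⟩
  -- `w` is the orbit of `z b` under the `a`-th iterate, which is the identity modulo `s ^ 2`.
  let w : ℤ → ι → A := fun m => z (a * m + b)
  let T := iterMap P a
  have hiter : ∀ (k : ℕ) (m : ℤ), z (m + k) = (fun x i => eval x (P i))^[k] (z m) := by
    intro k m
    induction k with
    | zero => simp
    | succ k ih =>
      rw [Function.iterate_succ_apply', ← ih, ← hz]
      congr 1
      push_cast
      ring
  have hw : ∀ m, w (m + 1) = fun i => eval (w m) (T i) := by
    intro m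
    rw [eval_iterMap, ← hiter]
    change z _ = z _
    congr 1
    ring
  have hT : ∀ (i : ι) (x : ι → A), s ^ 2 ∣ eval x (T i) - x i := by
    intro i x
    have h1 := hmod x i
    rw [← eval_iterMap, Ideal.mem_span_singleton] at h1
    exact h1
  have hwmod : ∀ m i, s ^ 2 ∣ w m i - w 0 i := by
    intro m i
    induction m using Int.induction_on with
    | zero => simp
    | succ m ih =>
      have h1 := hT i (w m)
      have h2 : w (m + 1) i = eval (w m) (T i) := congrFun (hw m) i
      rw [← h2] at h1
      simpa using dvd_add h1 ih
    | pred m ih =>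
      have h1 := hT i (w (-m - 1))
      have h2 : w (-m - 1 + 1) i = eval (w (-m - 1)) (T i) := congrFun (hw _) i
      rw [← h2, sub_add_cancel] at h1
      simpa using dvd_sub ih h1
  choose c hc using hwmod
  let y : ℤ → ι → A := fun m i => s * c m i
  have hwy : ∀ m, w m = w 0 + s • y m := by
    intro m
    ext i
    simp only [Pi.add_apply, Pi.smul_apply, smul_eq_mul, y]
    linear_combination hc m i
  choose S hS using fun i => exists_eval_eq_of_dvd_sub (T i) i (w 0) hsreg (hT i)
  have hy : ∀ m, y (m + 1) = y m + s • fun i => eval (y m) (S i) := by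
    intro m
    ext i
    have h1 := congrFun (hw m) i
    rw [hwy (m + 1), hwy m, hS] at h1
    simp only [Pi.add_apply, Pi.smul_apply, smul_eq_mul, add_right_inj] at h1 ⊢
    exact (mul_cancel_left_mem_nonZeroDivisors hsreg).1 h1
  let h' : MvPolynomial ι A := bind₁ (fun i => C (w 0 i) + C s * X i) h
  have hh' : ∀ m, eval (w m) h = eval (y m) h' := by
    intro m
    rw [eval_bind₁_eq, hwy m]
    congr 2
    ext i
    simp
  -- Each coordinate of `m ↦ h (w m)` in a `ℤ_[p]`-basis vanishes identically.
  have hcoord : ∀ j m, B.repr (eval (w m) h) j = 0 := by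
    intro j
    refine PadicInt.eq_zero_of_dvd_fwdDiff (fun m => B.repr (eval (w m) h) j) ?_ ?_
    · intro k m
      obtain ⟨R, hR⟩ := exists_fwdDiff_iter_eval_eq S s y hy h' k
      have hlin : ∀ (u : ℤ → A) (k : ℕ), (fwdDiff 1)^[k] (fun m => B.repr (u m) j) =
          fun m => B.repr ((fwdDiff 1)^[k] u m) j := by
        intro u k
        induction k with
        | zero => rfl
        | succ k ih =>
          rw [Function.iterate_succ_apply', ih, Function.iterate_succ_apply']
          ext m
          simp [fwdDiff]
      rw [hlin (fun m => eval (w m) h)]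
      simp_rw [hh']
      rw [hR]
      beta_reduce
      rw [hsmul, map_smul, Finsupp.smul_apply, smul_eq_mul]
      exact dvd_mul_right _ _
    · refine hb.mono fun n hn => ?_
      have h1 : eval (w n) h = 0 := by
        have h2 : eval (z ((a * n + b : ℕ) : ℤ)) h = 0 := hn
        push_cast at h2
        exact h2
      simp [h1]
  intro m
  exact B.repr.injective (Finsupp.ext fun j => by simpa using hcoord j m)

/-! ### Embedding finitely generated domains into finite free `ℤ_[p]`-algebras -/

/-- There are arbitrarily many algebraically independent `p`-adic integers, because `ℤ_[p]` is
uncountable. -/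
theorem PadicInt.exists_algebraicIndependent (p : ℕ) [hp : Fact p.Prime] (n : ℕ) :
    ∃ t : Fin n → ℤ_[p], AlgebraicIndependent ℤ t := by
  obtain ⟨s, hs⟩ := exists_isTranscendenceBasis ℤ ℤ_[p]
  have hinf : Infinite s := by
    by_contra hfin
    rw [not_infinite_iff_finite] at hfin
    have := hs.isAlgebraic
    have hc : Countable (Algebra.adjoin ℤ (Set.range ((↑) : s → ℤ_[p]))) := by
      have h := Algebra.lift_cardinalMk_adjoin_le ℤ (Set.range ((↑) : s → ℤ_[p]))
      rw [← Cardinal.mk_le_aleph0_iff]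
      have h2 : Cardinal.mk (Set.range ((↑) : s → ℤ_[p])) ≤ Cardinal.aleph0 :=
        Cardinal.mk_le_aleph0_iff.2 inferInstance
      simpa [h2] using h
    have h1 := Algebra.IsAlgebraic.lift_cardinalMk_le_max
      (Algebra.adjoin ℤ (Set.range ((↑) : s → ℤ_[p]))) ℤ_[p]
    have hc' : Countable ℤ_[p] := by
      rw [← Cardinal.mk_le_aleph0_iff]
      have h2 := Cardinal.mk_le_aleph0_iff.2 hc
      rw [Cardinal.lift_id, Cardinal.lift_id] at h1
      exact h1.trans (max_le h2 le_rfl)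
    have hq : Countable ℚ_[p] := by
      have hsurj : Function.Surjective (fun x : ℤ_[p] × ℤ_[p] => (x.1 : ℚ_[p]) / x.2) := by
        intro x
        obtain ⟨a, b, _, h⟩ := IsFractionRing.div_surjective (A := ℤ_[p]) x
        exact ⟨(a, b), h⟩
      exact hsurj.countable
    have h3 := continuum_le_cardinal_of_nontriviallyNormedField ℚ_[p]
    exact absurd (h3.trans (Cardinal.mk_le_aleph0_iff.2 hq)) (not_le.2 Cardinal.aleph0_lt_continuum)
  let e : Fin n ↪ s := Fin.valEmbedding.trans (Infinite.natEmbedding s)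
  exact ⟨_, hs.1.comp e e.injective⟩

/-- Clearing denominators in an equation of integral dependence over `ℚ[t]`. -/
theorem MvPolynomial.exists_natCast_mul_isIntegralElem {σ R : Type*} [CommRing R]
    (g : MvPolynomial σ ℚ →+* R) (hg : g.IsIntegral) (x : R) :
    ∃ N : ℕ, N ≠ 0 ∧ (g.comp (map (Int.castRingHom ℚ))).IsIntegralElem ((N : R) * x) := by
  let _ : Algebra (MvPolynomial σ ℤ) (MvPolynomial σ ℚ) := algebraMvPolynomial
  let _ : Algebra (MvPolynomial σ ℚ) R := g.toAlgebra
  let _ : Algebra (MvPolynomial σ ℤ) R := (g.comp (map (Int.castRingHom ℚ))).toAlgebra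
  have : IsScalarTower (MvPolynomial σ ℤ) (MvPolynomial σ ℚ) R :=
    IsScalarTower.of_algebraMap_eq fun _ => rfl
  have hint : IsIntegral (MvPolynomial σ ℚ) x := hg x
  obtain ⟨⟨_, m, hm, rfl⟩, h⟩ := IsIntegral.exists_multiple_integral_of_isLocalization
    (Submonoid.map (C (σ := σ)) (nonZeroDivisors ℤ)) x hint
  have h' : (g.comp (map (Int.castRingHom ℚ))).IsIntegralElem ((m : R) * x) := by
    change IsIntegral (MvPolynomial σ ℤ) _ at h
    rw [Submonoid.smul_def, Algebra.smul_def] at h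
    have h1 : algebraMap (MvPolynomial σ ℤ) R (C m) = (m : R) := by simp
    rw [h1] at h
    exact h
  refine ⟨m.natAbs, by simpa using nonZeroDivisors.ne_zero hm, ?_⟩
  rcases Int.natAbs_eq m with hm' | hm'
  · have : ((m.natAbs : ℕ) : R) = (m : R) := by
      conv_rhs => rw [hm']
      simp
    rwa [this]
  · have : ((m.natAbs : ℕ) : R) = -(m : R) := by
      conv_rhs => rw [hm']
      simp
    rw [this, neg_mul]
    exact h'.neg

/-- Extension of an injective homomorphism to an algebraically closed field along an injective
algebraic ring extension. -/
theorem IsAlgClosed.exists_injective_extension {B R M : Type*} [CommRing B] [IsDomain B]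
    [CommRing R] [IsDomain R] [Field M] [IsAlgClosed M] (g : B →+* R) (hg : Function.Injective g)
    (halg : @Algebra.IsAlgebraic B R _ _ g.toAlgebra) (φ : B →+* M) (hφ : Function.Injective φ) :
    ∃ ψ : R →+* M, Function.Injective ψ ∧ ψ.comp g = φ := by
  let _ : Algebra B R := g.toAlgebra
  let _ : Algebra B M := φ.toAlgebra
  have : Module.IsTorsionFree B R := Module.isTorsionFree_iff_algebraMap_injective.2 hg
  have : Module.IsTorsionFree B M := Module.isTorsionFree_iff_algebraMap_injective.2 hφ
  have := halg
  let ψ : R →ₐ[B] M := IsAlgClosed.lift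
  refine ⟨ψ, ?_, ψ.comp_algebraMap⟩
  rw [injective_iff_map_eq_zero]
  intro x hx
  by_contra hx0
  obtain ⟨r, hr0, y, hy⟩ := (Algebra.IsAlgebraic.isAlgebraic (R := B) x).exists_nonzero_dvd
    (mem_nonZeroDivisors_of_ne_zero hx0)
  have h1 : φ r = 0 := by
    have h2 := ψ.commutes r
    rw [hy, map_mul] at h2
    change ψ x = 0 at hx
    rw [hx, zero_mul] at h2
    exact h2.symm
  exact hr0 (hφ (by rw [h1, map_zero]))

/-- A finitely generated domain of characteristic zero embeds into a finite free algebra over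
`ℤ_[p]` for some prime `p`. By Noether normalization the domain is integral over a polynomial
ring `ℚ[t]`, up to denominators that a suitable `p` does not divide; the variables are sent to
algebraically independent `p`-adic integers, and the map is extended to an algebraic closure
of `ℚ_[p]`. -/
theorem exists_injective_to_finite_free_padicInt_algebra {K : Type*} [Field K] [CharZero K]
    {S : Set K} (hS : S.Finite) :
    ∃ (p : ℕ) (_ : Fact p.Prime) (A : Type) (_ : CommRing A) (_ : Algebra ℤ_[p] A)
      (_ : Module.Finite ℤ_[p] A) (_ : Module.Free ℤ_[p] A) (φ : Algebra.adjoin ℤ S →+* A),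
      Function.Injective φ := by
  classical
  let R := Algebra.adjoin ℚ S
  have hft : Algebra.FiniteType ℚ R :=
    (Subalgebra.fg_iff_finiteType _).1 (Subalgebra.fg_def.2 ⟨S, hS, rfl⟩)
  obtain ⟨s, g, hginj, hgfin⟩ := exists_finite_inj_algHom_of_fg ℚ R
  let B := MvPolynomial (Fin s) ℤ
  let gZ : B →+* R := (g : MvPolynomial (Fin s) ℚ →+* R).comp
    (MvPolynomial.map (Int.castRingHom ℚ))
  have hgint : (g : MvPolynomial (Fin s) ℚ →+* R).IsIntegral :=
    RingHom.IsIntegral.of_finite hgfin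
  have hgZinj : Function.Injective gZ :=
    hginj.comp (MvPolynomial.map_injective _ (RingHom.injective_int _))
  choose N hN0 hN using MvPolynomial.exists_natCast_mul_isIntegralElem _ hgint
  have halg : @Algebra.IsAlgebraic B R _ _ gZ.toAlgebra := by
    let _ : Algebra B R := gZ.toAlgebra
    have htf : Module.IsTorsionFree B R := Module.isTorsionFree_iff_algebraMap_injective.2 hgZinj
    refine ⟨fun x => ?_⟩
    have h1 : IsAlgebraic B ((N x : R) * x) := IsIntegral.isAlgebraic (hN x)
    have h2 : ((N x : R) * x) = (N x : B) • x := by rw [Algebra.smul_def, map_natCast]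
    rw [h2] at h1
    exact h1.of_smul (mem_nonZeroDivisors_of_ne_zero (Nat.cast_ne_zero.2 (hN0 x)))
  -- The prime `p` avoids the denominators of the generators.
  let D : ℕ := ∏ x ∈ hS.toFinset.attach, N ⟨x, Algebra.subset_adjoin (hS.mem_toFinset.1 x.2)⟩
  have hD0 : D ≠ 0 := Finset.prod_ne_zero_iff.2 fun x _ => hN0 _
  obtain ⟨p, hpD, hp⟩ := Nat.exists_infinite_primes (D + 1)
  have hpf : Fact p.Prime := ⟨hp⟩
  obtain ⟨t, ht⟩ := PadicInt.exists_algebraicIndependent p s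
  let M := AlgebraicClosure ℚ_[p]
  let φ₀ : B →+* ℤ_[p] := (MvPolynomial.aeval t : B →ₐ[ℤ] ℤ_[p])
  have hMinj : Function.Injective (algebraMap ℤ_[p] M) := by
    rw [IsScalarTower.algebraMap_eq ℤ_[p] ℚ_[p] M]
    exact (algebraMap ℚ_[p] M).injective.comp (IsFractionRing.injective ℤ_[p] ℚ_[p])
  obtain ⟨ψ, hψ, hψg⟩ := IsAlgClosed.exists_injective_extension gZ hgZinj halg
    ((algebraMap ℤ_[p] M).comp φ₀) (hMinj.comp ht)
  let A := Algebra.adjoin ℤ_[p] {y : M | ∃ (x : K) (hx : x ∈ S),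
    y = ψ ⟨x, Algebra.subset_adjoin hx⟩}
  have hAint : ∀ y ∈ {y : M | ∃ (x : K) (hx : x ∈ S), y = ψ ⟨x, Algebra.subset_adjoin hx⟩},
      IsIntegral ℤ_[p] y := by
    rintro _ ⟨x, hx, rfl⟩
    set x' : R := ⟨x, Algebra.subset_adjoin hx⟩ with hx'
    have hu : IsUnit (N x' : ℤ_[p]) := by
      rw [PadicInt.isUnit_iff, PadicInt.norm_natCast_eq_one_iff, hp.coprime_iff_not_dvd]
      intro hdvd
      have h1 : N x' ∣ D := Finset.dvd_prod_of_mem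
        (fun x : {x // x ∈ hS.toFinset} =>
          N ⟨x, Algebra.subset_adjoin (hS.mem_toFinset.1 x.2)⟩)
        (Finset.mem_attach _ ⟨x, hS.mem_toFinset.2 hx⟩)
      have := Nat.le_of_dvd (Nat.pos_of_ne_zero hD0) (hdvd.trans h1)
      omega
    obtain ⟨u, hu⟩ := hu
    let _ : Algebra B R := gZ.toAlgebra
    have h1 : IsIntegral B ((N x' : R) * x') := hN x'
    have h2 : IsIntegral ℤ_[p] (ψ ((N x' : R) * x')) :=
      h1.map_of_comp_eq φ₀ ψ hψg.symm
    have h3 : ψ x' = algebraMap ℤ_[p] M (↑u⁻¹ : ℤ_[p]) * ψ ((N x' : R) * x') := by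
      have h4 : algebraMap ℤ_[p] M (↑u⁻¹ : ℤ_[p]) * (N x' : M) = 1 := by
        have : (N x' : M) = algebraMap ℤ_[p] M u := by rw [hu, map_natCast]
        rw [this, ← map_mul, Units.inv_mul, map_one]
      rw [map_mul, map_natCast, ← mul_assoc, h4, one_mul]
    rw [h3]
    exact isIntegral_algebraMap.mul h2
  have hfinset : {y : M | ∃ (x : K) (hx : x ∈ S), y = ψ ⟨x, Algebra.subset_adjoin hx⟩}.Finite := by
    have : Finite S := hS
    refine (Set.finite_range fun x : S => ψ ⟨x, Algebra.subset_adjoin x.2⟩).subset ?_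
    rintro _ ⟨x, hx, rfl⟩
    exact ⟨⟨x, hx⟩, rfl⟩
  have hAfin : Module.Finite ℤ_[p] A :=
    Module.Finite.iff_fg.2 (fg_adjoin_of_finite hfinset hAint)
  have hAtf : Module.IsTorsionFree ℤ_[p] A := by
    refine Module.isTorsionFree_iff_algebraMap_injective.2 fun x y h => hMinj ?_
    exact congrArg Subtype.val h
  have hAfree : Module.Free ℤ_[p] A := Module.free_of_finite_type_torsion_free'
  have hle : Algebra.adjoin ℤ S ≤ R.restrictScalars ℤ := Algebra.adjoin_le Algebra.subset_adjoin
  let θ : Algebra.adjoin ℤ S →+* M := ψ.comp (Subalgebra.inclusion hle).toRingHom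
  have hθ : ∀ x, θ x ∈ A := by
    rintro ⟨x, hx⟩
    induction hx using Algebra.adjoin_induction with
    | mem x hx => exact Algebra.subset_adjoin ⟨x, hx, rfl⟩
    | algebraMap r =>
      have : θ ⟨algebraMap ℤ K r, Subalgebra.algebraMap_mem _ r⟩ = (r : M) := by
        rw [← map_intCast θ]
        congr 1
      rw [this]
      exact intCast_mem _ r
    | add x y hx hy h1 h2 =>
      have : θ ⟨x + y, add_mem hx hy⟩ = θ ⟨x, hx⟩ + θ ⟨y, hy⟩ := map_add θ ⟨x, hx⟩ ⟨y, hy⟩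
      rw [this]
      exact add_mem h1 h2
    | mul x y hx hy h1 h2 =>
      have : θ ⟨x * y, mul_mem hx hy⟩ = θ ⟨x, hx⟩ * θ ⟨y, hy⟩ := map_mul θ ⟨x, hx⟩ ⟨y, hy⟩
      rw [this]
      exact mul_mem h1 h2
  refine ⟨p, hpf, A, inferInstance, inferInstance, hAfin, hAfree, θ.codRestrict A hθ, ?_⟩
  intro x y hxy
  have h1 : θ x = θ y := congrArg Subtype.val hxy
  exact Subalgebra.inclusion_injective hle (hψ h1)

/-! ### Orbits of invertible polynomial maps in characteristic zero -/

namespace MvPolynomial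

/-- The Skolem-Mahler-Lech theorem for invertible polynomial maps of affine space over a field of
characteristic zero: if a polynomial vanishes at infinitely many points of a forward orbit, then
it vanishes along a two-sided arithmetic progression of the orbit. -/
theorem exists_eval_orbit_eq_zero {K ι : Type*} [Field K] [CharZero K] [Finite ι]
    (P Q : ι → MvPolynomial ι K) (hPQ : ∀ i, bind₁ P (Q i) = X i)
    (z : ℤ → ι → K) (hz : ∀ m, z (m + 1) = fun i => eval (z m) (P i))
    (h : MvPolynomial ι K) (hinf : {n : ℕ | eval (z n) h = 0}.Infinite) :
    ∃ a : ℕ, 0 < a ∧ ∃ b : ℤ, ∀ m : ℤ, eval (z (a * m + b)) h = 0 := by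
  let S : Set K := (⋃ i, ((P i).coeffs : Set K)) ∪ (⋃ i, ((Q i).coeffs : Set K)) ∪
    (h.coeffs : Set K) ∪ Set.range (z 0)
  have hS : S.Finite := (((Set.finite_iUnion fun _ => Finset.finite_toSet _).union
    (Set.finite_iUnion fun _ => Finset.finite_toSet _)).union (Finset.finite_toSet _)).union
    (Set.finite_range _)
  obtain ⟨p, hp, A, _, _, _, _, φ, hφ⟩ := exists_injective_to_finite_free_padicInt_algebra hS
  let R := Algebra.adjoin ℤ S
  let j : R →+* K := R.val
  have hj : Function.Injective j := Subtype.val_injective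
  have hlift : ∀ f : MvPolynomial ι K, (f.coeffs : Set K) ⊆ S → ∃ f' : MvPolynomial ι R,
      map j f' = f := by
    intro f hf
    refine mem_range_map_iff_coeffs_subset.2 (hf.trans fun x hx => ?_)
    exact ⟨⟨x, Algebra.subset_adjoin hx⟩, rfl⟩
  choose P' hP' using fun i => hlift (P i) fun x hx =>
    Or.inl (Or.inl (Or.inl (Set.mem_iUnion.2 ⟨i, hx⟩)))
  choose Q' hQ' using fun i => hlift (Q i) fun x hx =>
    Or.inl (Or.inl (Or.inr (Set.mem_iUnion.2 ⟨i, hx⟩)))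
  obtain ⟨h', hh'⟩ := hlift h fun x hx => Or.inl (Or.inr hx)
  have hzR : ∀ m, ∃ x : ι → R, z m = fun i => j (x i) := by
    intro m
    induction m using Int.induction_on with
    | zero => exact ⟨fun i => ⟨z 0 i, Algebra.subset_adjoin (Or.inr ⟨i, rfl⟩)⟩, rfl⟩
    | succ m ih =>
      obtain ⟨x, hx⟩ := ih
      refine ⟨fun i => eval x (P' i), ?_⟩
      rw [hz, hx]
      ext i
      rw [← hP', eval_map_comp]
    | pred m ih =>
      obtain ⟨x, hx⟩ := ih
      refine ⟨fun i => eval x (Q' i), ?_⟩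
      ext i
      have h1 := hz (-m - 1)
      rw [sub_add_cancel] at h1
      rw [← eval_map_comp, ← hx, hQ', h1, ← eval_bind₁_eq, hPQ, eval_X]
  choose x hx using hzR
  have hxrec : ∀ m, x (m + 1) = fun i => eval (x m) (P' i) := by
    intro m
    ext i
    have h1 := congrFun (hz m) i
    rw [hx, hx, ← hP', eval_map_comp] at h1
    exact h1
  have hzero : ∀ m, eval (z m) h = 0 ↔ eval (fun i => φ (x m i)) (map φ h') = 0 := by
    intro m
    rw [hx, ← hh', eval_map_comp, eval_map_comp, map_eq_zero_iff j hj, map_eq_zero_iff φ hφ]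
  simp_rw [hzero] at hinf ⊢
  refine PadicInt.exists_eval_orbit_eq_zero (p := p) (fun i => map φ (P' i)) (fun i => map φ (Q' i)) ?_
    (fun m i => φ (x m i)) ?_ _ hinf
  · intro i
    rw [← map_bind₁]
    have h1 : bind₁ P' (Q' i) = X i := by
      apply map_injective j hj
      rw [map_bind₁, map_X, hQ', ← hPQ i]
      simp_rw [hP']
    rw [h1, map_X]
  · intro m
    ext i
    rw [eval_map_comp, hxrec]

/-- The Hénon-type polynomial map `(a, b) ↦ (b + F a, a - G (b + F a))` of `A²ⁿ`. Its inverse has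
the same shape with `F` and `G` exchanged; if `G` inverts `F` on a set `Y`, then it extends the map
`F` from `Y × 0` to the whole space. -/
noncomputable def henonMap {K ι : Type*} [CommRing K] (F G : ι → MvPolynomial ι K) :
    ι ⊕ ι → MvPolynomial (ι ⊕ ι) K :=
  let c := fun i => X (Sum.inr i) + rename Sum.inl (F i)
  Sum.elim c fun i => X (Sum.inl i) - bind₁ c (G i)

theorem bind₁_henonMap {K ι : Type*} [CommRing K] (F G : ι → MvPolynomial ι K) (i : ι ⊕ ι) :
    bind₁ (henonMap F G) (henonMap G F i) = X i := by
  have hinl : ∀ i, bind₁ (henonMap F G) (henonMap G F (Sum.inl i)) = X (Sum.inl i) := by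
    intro i
    simp only [henonMap, Sum.elim_inl, map_add, bind₁_X_right, Sum.elim_inr, bind₁_rename]
    exact sub_add_cancel _ _
  rcases i with i | i
  · exact hinl i
  · change bind₁ (henonMap F G)
      (X (Sum.inl i) - bind₁ (fun j => henonMap G F (Sum.inl j)) (F i)) = _
    rw [map_sub, bind₁_X_right, bind₁_bind₁]
    simp_rw [hinl]
    have hren : bind₁ (fun i => X (Sum.inl i : ι ⊕ ι)) (F i) = rename Sum.inl (F i) := by
      rw [bind₁, rename_eq_aeval]
      rfl
    rw [hren]
    exact add_sub_cancel_right _ _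

end MvPolynomial

/-! ### Zariski topology and polynomial maps -/

namespace AffSpace

theorem mem_zeros_iff_le_ker {K : Type*} [Field K] {n : ℕ} {I : Ideal (MvPolynomial (Fin n) K)}
    {x : AffSpace K n} : x ∈ zeros I ↔ I ≤ RingHom.ker (MvPolynomial.eval x.coords) :=
  mem_zeros

theorem IsPolynomialMap.continuous {K : Type*} [Field K] {n : ℕ} {Y : Set (AffSpace K n)}
    {f : Y → Y} (hf : IsPolynomialMap f) : Continuous f := by
  obtain ⟨F, hF⟩ := hf
  rw [continuous_iff_isClosed]
  intro Z hZ
  obtain ⟨Z', hZ', rfl⟩ := isClosed_induced_iff.1 hZ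
  obtain ⟨I, rfl⟩ := isClosed_iff.1 hZ'
  refine isClosed_induced_iff.2
    ⟨zeros (I.map (MvPolynomial.bind₁ F)), isClosed_iff.2 ⟨_, rfl⟩, ?_⟩
  ext y
  have hfy : (f y).1.coords = fun i => MvPolynomial.eval y.1.coords (F i) := funext (hF y)
  simp only [Set.mem_preimage, mem_zeros_iff_le_ker, Ideal.map_le_iff_le_comap]
  refine forall₂_congr fun p _ => ?_
  simp only [Ideal.mem_comap, RingHom.mem_ker]
  rw [hfy, ← MvPolynomial.eval_bind₁_eq]

theorem IsAutomorphism.inv {K : Type*} [Field K] {n : ℕ} {Y : Set (AffSpace K n)}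
    {σ : Equiv.Perm Y} (hσ : IsAutomorphism σ) : IsAutomorphism σ⁻¹ :=
  ⟨hσ.2, hσ.1⟩

theorem IsAutomorphism.continuous_zpow {K : Type*} [Field K] {n : ℕ} {Y : Set (AffSpace K n)}
    {σ : Equiv.Perm Y} (hσ : IsAutomorphism σ) (m : ℤ) : Continuous (σ ^ m) := by
  have hpow : ∀ (τ : Equiv.Perm Y), IsAutomorphism τ → ∀ k : ℕ, Continuous (τ ^ k) := by
    intro τ hτ k
    rw [Equiv.Perm.coe_pow]
    exact hτ.1.continuous.iterate k
  obtain ⟨k, rfl | rfl⟩ := m.eq_nat_or_neg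
  · rw [zpow_natCast]
    exact hpow σ hσ k
  · rw [zpow_neg, zpow_natCast, ← inv_pow]
    exact hpow σ⁻¹ hσ.inv k

/-- If a forward orbit of an automorphism meets a proper closed subset infinitely often, then a
two-sided arithmetic progression of the orbit lies in some proper closed subset. -/
theorem IsAutomorphism.exists_zpow_mem {K : Type*} [Field K] [CharZero K] {n : ℕ}
    {Y : Set (AffSpace K n)} {σ : Equiv.Perm Y} (hσ : IsAutomorphism σ) (q : Y) {X : Set Y}
    (hX : IsClosed X) (hXne : X ≠ Set.univ) (hinf : {k : ℕ | (σ ^ (k : ℤ)) q ∈ X}.Infinite) :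
    ∃ X' : Set Y, IsClosed X' ∧ X' ≠ Set.univ ∧
      ∃ a : ℕ, 0 < a ∧ ∃ b : ℤ, ∀ m : ℤ, (σ ^ (a * m + b)) q ∈ X' := by
  open MvPolynomial in
  obtain ⟨Z, hZ, rfl⟩ := isClosed_induced_iff.1 hX
  obtain ⟨I, rfl⟩ := isClosed_iff.1 hZ
  obtain ⟨y, hy⟩ := (Set.ne_univ_iff_exists_notMem _).1 hXne
  simp only [Set.mem_preimage, mem_zeros, not_forall] at hy
  obtain ⟨f, hfI, hfy⟩ := hy
  obtain ⟨⟨F, hF⟩, ⟨G, hG⟩⟩ := hσ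
  let z : ℤ → Fin n ⊕ Fin n → K := fun m => Sum.elim ((σ ^ m) q).1.coords 0
  have hz : ∀ m, z (m + 1) = fun i => eval (z m) (henonMap F G i) := by
    intro m
    have hnext : (σ ^ (m + 1)) q = σ ((σ ^ m) q) := by
      rw [add_comm, zpow_add, zpow_one, Equiv.Perm.mul_apply]
    have hinl : ∀ i, eval (z m) (henonMap F G (Sum.inl i)) = ((σ ^ (m + 1)) q).1.coords i := by
      intro i
      rw [hnext, hF]
      simp only [henonMap, Sum.elim_inl, map_add, eval_X, eval_rename, z, Sum.elim_inr,
        Pi.zero_apply, zero_add]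
      rfl
    ext i
    rcases i with i | i
    · exact (hinl i).symm
    · change 0 = eval (z m)
        (X (Sum.inl i) - bind₁ (fun j => henonMap F G (Sum.inl j)) (G i))
      have h1 : eval (z m) (bind₁ (fun j => henonMap F G (Sum.inl j)) (G i)) =
          eval (fun j => eval (z m) (henonMap F G (Sum.inl j))) (G i) :=
        eval₂Hom_bind₁ _ _ _ _
      have h2 := hG ((σ ^ (m + 1)) q) i
      rw [hnext, Equiv.symm_apply_apply, ← hnext] at h2
      simp_rw [hinl] at h1
      rw [map_sub, h1, eval_X]
      exact (sub_eq_zero.2 h2).symm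
  have hfz : ∀ m, eval (z m) (rename Sum.inl f) = eval ((σ ^ m) q).1.coords f := by
    intro m
    rw [eval_rename]
    rfl
  obtain ⟨a, ha, b, hab⟩ := exists_eval_orbit_eq_zero (henonMap F G) (henonMap G F)
    (bind₁_henonMap F G) z hz (rename Sum.inl f) (hinf.mono fun k hk => by
      change eval _ _ = 0
      rw [hfz]
      exact mem_zeros.1 hk f hfI)
  have hmem : ∀ x : Y, x ∈ (Subtype.val ⁻¹' zeros (Ideal.span {f}) : Set Y) ↔
      eval x.1.coords f = 0 := by
    intro x
    rw [Set.mem_preimage, mem_zeros_iff_le_ker, Ideal.span_singleton_le_iff_mem, RingHom.mem_ker]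
  refine ⟨Subtype.val ⁻¹' zeros (Ideal.span {f}),
    isClosed_induced_iff.2 ⟨_, isClosed_iff.2 ⟨_, rfl⟩, rfl⟩, fun h => ?_, a, ha, b, fun m => ?_⟩
  · exact hfy ((hmem y).1 (h ▸ Set.mem_univ y))
  · rw [hmem, ← hfz]
    exact hab m

/-- A dense orbit of an automorphism of a variety meets a proper closed subset only finitely often
in the forward direction: otherwise finitely many translates of a proper closed subset would
cover the variety. -/
theorem IsAutomorphism.finite_of_dense {K : Type*} [Field K] [CharZero K] {n : ℕ}
    {Y : Set (AffSpace K n)} (hY : IsIrreducible Y) {σ : Equiv.Perm Y} (hσ : IsAutomorphism σ)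
    {q : Y} (hq : Dense (Set.range fun m : ℤ => (σ ^ m) q)) {X : Set Y}
    (hX : IsClosed X) (hXne : X ≠ Set.univ) : {k : ℕ | (σ ^ (k : ℤ)) q ∈ X}.Finite := by
  classical
  by_contra hinf
  obtain ⟨X', hX', hX'ne, a, ha, b, hab⟩ := hσ.exists_zpow_mem q hX hXne hinf
  let T : Finset (Set Y) := (Finset.range a).image fun i : ℕ => (σ ^ (-i : ℤ)) ⁻¹' X'
  have hclosed : ∀ t ∈ T, IsClosed t := by
    intro t ht
    obtain ⟨i, _, rfl⟩ := Finset.mem_image.1 ht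
    exact hX'.preimage (hσ.continuous_zpow _)
  have hcover : Set.univ ⊆ ⋃₀ (T : Set (Set Y)) := by
    rw [← hq.closure_eq]
    refine closure_minimal ?_ (by
      rw [Set.sUnion_eq_biUnion]
      exact T.finite_toSet.isClosed_biUnion hclosed)
    rintro _ ⟨m, rfl⟩
    -- Write `m - b = a * d + r` with `0 ≤ r < a`.
    have hr0 : 0 ≤ (m - b) % a := Int.emod_nonneg _ (by omega)
    have hra : (m - b) % a < a := Int.emod_lt_of_pos _ (by omega)
    refine ⟨_, Finset.mem_coe.2 (Finset.mem_image.2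
      ⟨((m - b) % a).toNat, Finset.mem_range.2 (by omega), rfl⟩), ?_⟩
    have h1 := hab ((m - b) / a)
    have h2 : (a : ℤ) * ((m - b) / a) + b = -(((m - b) % a).toNat : ℤ) + m := by
      have := Int.emod_add_mul_ediv (m - b) a
      rw [Int.toNat_of_nonneg hr0]
      linarith
    rw [h2, zpow_add, Equiv.Perm.mul_apply] at h1
    exact h1
  have : IrreducibleSpace Y := isIrreducible_iff_irreducibleSpace.1 hY
  obtain ⟨t, ht, hsub⟩ := isIrreducible_iff_sUnion_isClosed.1
    (IrreducibleSpace.isIrreducible_univ Y) T hclosed hcover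
  obtain ⟨i, _, rfl⟩ := Finset.mem_image.1 ht
  refine hX'ne (Set.eq_univ_of_forall fun x => ?_)
  obtain ⟨y, rfl⟩ := (σ ^ (-i : ℤ)).surjective x
  exact hsub (Set.mem_univ y)

end AffSpace

theorem mainTheorem4 {K : Type*} [Field K] [CharZero K] (n : ℕ)
    (Y : Set (AffSpace K n)) (hY : AffSpace.IsAffineVariety Y)
    (σ : Equiv.Perm Y) (hσ : AffSpace.IsAutomorphism σ) (q : Y) :
    Dense (Set.range fun m : ℤ => (σ ^ m) q) ↔
      ∀ X : Set Y, IsClosed X → X ≠ Set.univ → {m : ℤ | (σ ^ m) q ∈ X}.Finite := by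
  constructor
  · intro hq X hX hXne
    have hq' : Dense (Set.range fun m : ℤ => (σ⁻¹ ^ m) q) := by
      have h : (Set.range fun m : ℤ => (σ⁻¹ ^ m) q) = Set.range fun m : ℤ => (σ ^ m) q := by
        rw [← (Equiv.neg ℤ).surjective.range_comp fun m : ℤ => (σ ^ m) q]
        simp [Function.comp_def]
      rwa [h]
    have hpos := hσ.finite_of_dense hY.2 hq hX hXne
    have hneg := hσ.inv.finite_of_dense hY.2 hq' hX hXne
    refine ((hpos.image fun k : ℕ => (k : ℤ)).union
      (hneg.image fun k : ℕ => -(k : ℤ))).subset fun m hm => ?_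
    obtain ⟨k, rfl | rfl⟩ := m.eq_nat_or_neg
    · exact Or.inl ⟨k, hm, rfl⟩
    · refine Or.inr ⟨k, ?_, rfl⟩
      change (σ⁻¹ ^ (k : ℤ)) q ∈ X
      rw [inv_zpow']
      exact hm
  · intro h
    rw [dense_iff_closure_eq]
    by_contra hne
    refine Set.infinite_univ ((h _ isClosed_closure hne).subset fun m _ => ?_)
    exact subset_closure ⟨m, rfl⟩
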